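/- Let $(A,[\cdot,\cdot],\rho)$ be a Lie algebroid over a smooth manifold $M$, i.e. a smooth real vector bundle $A\to M$ with a Lie bracket on $\Gamma(A)$ and a bundle map $\rho:A\to TM$ such that $[X,fY]=f[X,Y]+(\rho(X)\cdot f)\,Y$ for $X,Y\in\Gamma(A)$, $f\in C^\infty(M)$. Let $(\pi,N)$ be a Poisson–Nijenhuis structure on $A$, so that $(A,\pi,N)$ is a PN-algebroid: - $\pi\in\Gamma(\wedge^2A)$ satisfies $[\pi,\pi]_A=0$ (Schouten bracket); write $\pi^\sharp:A^*\to A$, $\pi^\sharp\alpha=i_\alpha\pi$; - $N:A\to A$ is a bundle map over the identity with vanishing Nijenhuis torsion, i.e. $N[X,Y]_N=[NX,NY]$, where $[X,Y]_N=[NX,Y]+[X,NY]-N[X,Y]$; - $\pi$ and $N$ are compatible: $N\pi^\sharp=\pi^\sharp N^*$, so that $N\pi$, defined by $(N\pi)^\sharp=N\circ\pi^\sharp$, is a bivector; and $[\alpha,\beta]_{N\pi}=[N^*\alpha,\beta]_\pi+[\alpha,N^*\beta]_\pi-N^*[\alpha,\beta]_\pi$ for all $\alpha,\beta\in\Gamma(A^*)$,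 where $[\alpha,\beta]_\pi=\mathcal L_{\pi^\sharp\alpha}\beta-\mathcal L_{\pi^\sharp\beta}\alpha-d_A(\pi(\alpha,\beta))$. For a bivector $\pi'$ and a bundle map $N':A\to A$ let $$X_{(N',\pi')}=d_{\pi'}(\mathrm{Tr}\,N')=-\pi'^\sharp\big(d_A\,\mathrm{Tr}\,N'\big)$$ (for a PN-algebroid $(A,\pi',N')$ this is its modular vector field), and let $N^i\pi$ be the bivector with $(N^i\pi)^\sharp=N^i\circ\pi^\sharp$. Then for all natural numbers $i<k$ (with $i=0$ allowed) $$N^kX_{(N,\pi)}=\frac{1}{k-i+1}\,X_{(N^{k-i+1},\,N^i\pi)} .$$ -/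

import Mathlib

open Bundle
open scoped Manifold ContDiff

noncomputable section

namespace PN

section Bundles

variable {E : Type*} [NormedAddCommGroup E] [NormedSpace ℝ E]
  {H : Type*} [TopologicalSpace H] (I : ModelWithCorners ℝ E H)
  {M : Type*} [TopologicalSpace M] [ChartedSpace H M]
  (F₁ : Type*) [NormedAddCommGroup F₁] [NormedSpace ℝ F₁]
  (A₁ : M → Type*) [∀ x, AddCommGroup (A₁ x)] [∀ x, Module ℝ (A₁ x)]
  [TopologicalSpace (TotalSpace F₁ A₁)] [∀ x, TopologicalSpace (A₁ x)]
  [FiberBundle F₁ A₁] [VectorBundle ℝ F₁ A₁]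
  (F₂ : Type*) [NormedAddCommGroup F₂] [NormedSpace ℝ F₂]
  (A₂ : M → Type*) [∀ x, AddCommGroup (A₂ x)] [∀ x, Module ℝ (A₂ x)]
  [TopologicalSpace (TotalSpace F₂ A₂)] [∀ x, TopologicalSpace (A₂ x)]
  [FiberBundle F₂ A₂] [VectorBundle ℝ F₂ A₂]
  [∀ x, IsTopologicalAddGroup (A₂ x)] [∀ x, ContinuousSMul ℝ (A₂ x)]
  (F₃ : Type*) [NormedAddCommGroup F₃] [NormedSpace ℝ F₃]
  (A₃ : M → Type*) [∀ x, AddCommGroup (A₃ x)] [∀ x, Module ℝ (A₃ x)]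
  [TopologicalSpace (TotalSpace F₃ A₃)] [∀ x, TopologicalSpace (A₃ x)]
  [FiberBundle F₃ A₃] [VectorBundle ℝ F₃ A₃]
  [∀ x, IsTopologicalAddGroup (A₃ x)] [∀ x, ContinuousSMul ℝ (A₃ x)]

/-- Smooth vector bundle maps `A₁ → A₂` over the identity of `M`, that is, smooth sections of the
bundle `Hom(A₁, A₂)`. -/
abbrev BundleHom := Cₛ^∞⟮I; F₁ →L[ℝ] F₂, fun x : M => A₁ x →L[ℝ] A₂ x⟯

/-- The space `Γ(A)` of smooth sections of the vector bundle `A`. -/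
abbrev Sec := Cₛ^∞⟮I; F₁, A₁⟯

/-- The fibres of the dual bundle `A*`. -/
abbrev DualFibre (x : M) := A₁ x →L[ℝ] Trivial M ℝ x

/-- The space `Ω¹(A) = Γ(A*)` of smooth `A`-forms of degree one. -/
abbrev OneForm := BundleHom I F₁ A₁ ℝ (Trivial M ℝ)

/-- Smooth bundle maps `A → A` over the identity. -/
abbrev Endo := BundleHom I F₂ A₂ F₂ A₂

variable {I F₁ A₁ F₂ A₂ F₃ A₃}

/-- A smooth bundle map acting on smooth sections. -/
def BundleHom.app (φ : BundleHom I F₁ A₁ F₂ A₂) (X : Sec I F₁ A₁) : Sec I F₂ A₂ :=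
  ⟨fun x => φ x (X x), φ.contMDiff.clm_bundle_apply X.contMDiff⟩

/-- Composition of smooth bundle maps. -/
def BundleHom.comp (ψ : BundleHom I F₂ A₂ F₃ A₃) (φ : BundleHom I F₁ A₁ F₂ A₂) :
    BundleHom I F₁ A₁ F₃ A₃ :=
  ⟨fun x => (ψ x).comp (φ x), by
    intro x₀
    have hψ := (contMDiffAt_hom_bundle _).1 (ψ.contMDiff x₀)
    have hφ := (contMDiffAt_hom_bundle _).1 (φ.contMDiff x₀)
    refine (contMDiffAt_hom_bundle _).2 ⟨contMDiffAt_id, ?_⟩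
    refine (hψ.2.clm_comp hφ.2).congr_of_eventuallyEq ?_
    filter_upwards [(trivializationAt F₂ A₂ x₀).open_baseSet.mem_nhds
      (FiberBundle.mem_baseSet_trivializationAt' x₀)] with x hx
    ext v
    simp only [ContinuousLinearMap.inCoordinates, ContinuousLinearMap.comp_apply]
    rw [Trivialization.symmL_continuousLinearMapAt _ hx]⟩

/-- Multiplication of a section by a smooth function. -/
def Sec.fsmul (f : C^∞⟮I, M; ℝ⟯) (X : Sec I F₁ A₁) : Sec I F₁ A₁ :=
  ⟨fun x => f x • X x, f.contMDiff.smul_section X.contMDiff⟩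

end Bundles

section Algebroid

variable {E : Type*} [NormedAddCommGroup E] [NormedSpace ℝ E]
  {H : Type*} [TopologicalSpace H] (I : ModelWithCorners ℝ E H)
  {M : Type*} [TopologicalSpace M] [ChartedSpace H M] [IsManifold I ∞ M]
  (F : Type*) [NormedAddCommGroup F] [NormedSpace ℝ F]
  (A : M → Type*) [∀ x, AddCommGroup (A x)] [∀ x, Module ℝ (A x)]
  [TopologicalSpace (TotalSpace F A)] [∀ x, TopologicalSpace (A x)]
  [FiberBundle F A] [VectorBundle ℝ F A]
  [∀ x, IsTopologicalAddGroup (A x)] [∀ x, ContinuousSMul ℝ (A x)]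

variable {I} in
/-- The derivative `v·f` of a function along a tangent vector `v` at `x`. -/
def dirDeriv (f : M → ℝ) (x : M) (v : TangentSpace I x) : ℝ := mfderiv I 𝓘(ℝ, ℝ) f x v

/-- A Lie algebroid structure on the vector bundle `A → M`: a Lie bracket on `Γ(A)` and a bundle
map `ρ : A → TM` (the anchor) with `[X, fY] = f[X, Y] + (ρ(X)·f) Y`. (That `ρ` is a homomorphism
of brackets is a consequence of these axioms.) -/
structure LieAlgebroid where
  /-- the anchor -/
  anchor : BundleHom I F A E (TangentSpace I : M → Type _)
  /-- the bracket of sections -/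
  bracket : Sec I F A →ₗ[ℝ] Sec I F A →ₗ[ℝ] Sec I F A
  bracket_self : ∀ X, bracket X X = 0
  jacobi : ∀ X Y Z, bracket X (bracket Y Z) = bracket (bracket X Y) Z + bracket Y (bracket X Z)
  leibniz : ∀ (X Y : Sec I F A) (f : C^∞⟮I, M; ℝ⟯) (x : M),
    bracket X (Y.fsmul f) x =
      f x • bracket X Y x + dirDeriv f x (anchor x (X x)) • Y x

variable {I F A}

/-- The transpose `N*` of a bundle map `N : A → A`, acting on forms of degree one. -/
def Endo.transpose (N : Endo I F A) (α : OneForm I F A) : OneForm I F A :=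
  BundleHom.comp α N

/-- The power `N^k` of a bundle map `N : A → A`. -/
def Endo.pow [ContMDiffVectorBundle ∞ F A I]
    (N : Endo I F A) : ℕ → Endo I F A
  | 0 => ⟨fun x => ContinuousLinearMap.id ℝ (A x), by
      intro x₀
      refine (contMDiffAt_hom_bundle _).2 ⟨contMDiffAt_id, ?_⟩
      refine (contMDiffAt_const (c := ContinuousLinearMap.id ℝ F)).congr_of_eventuallyEq ?_
      filter_upwards [(trivializationAt F A x₀).open_baseSet.mem_nhds
        (FiberBundle.mem_baseSet_trivializationAt' x₀)] with x hx
      ext v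
      simp only [ContinuousLinearMap.inCoordinates, ContinuousLinearMap.comp_apply,
        ContinuousLinearMap.id_apply]
      rw [Trivialization.continuousLinearMapAt_symmL _ hx]⟩
  | k + 1 => BundleHom.comp N (Endo.pow N k)

/-- The function `Tr N` on `M`, the fibrewise trace. -/
def Endo.trace (N : Endo I F A) (x : M) : ℝ := LinearMap.trace ℝ (A x) (N x : A x →ₗ[ℝ] A x)

variable (I F A) in
/-- A bivector `π ∈ Γ(∧²A)`, given by its skew-symmetric bundle map `π♯ : A* → A`,
`π♯ α = i_α π`; thus `π(α, β) = β(π♯ α)`. -/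
structure Bivector where
  /-- the bundle map `π♯` -/
  sharp : BundleHom I (F →L[ℝ] ℝ) (DualFibre A) F A
  skew : ∀ (x : M) (a b : DualFibre A x), b (sharp x a) = -a (sharp x b)

namespace LieAlgebroid

variable (L : LieAlgebroid I F A)

/-- The differential `d_A f` of a function, `(d_A f)(X) = ρ(X)·f`, at the point `x`. -/
def d (f : M → ℝ) (x : M) : DualFibre A x :=
  (mfderiv I 𝓘(ℝ, ℝ) f x : TangentSpace I x →L[ℝ] ℝ).comp (L.anchor x)

/-- The differential of a form of degree one,
`(d_A β)(X, Y) = ρ(X)·β(Y) - ρ(Y)·β(X) - β([X, Y])`, as a function on `M`. -/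
def dOne (β : OneForm I F A) (X Y : Sec I F A) (x : M) : ℝ :=
  L.d (fun y => β y (Y y)) x (X x) - L.d (fun y => β y (X y)) x (Y x) - β x (L.bracket X Y x)

/-- The Lie derivative `ℒ_X β = d_A (i_X β) + i_X (d_A β)` of a form of degree one, evaluated on
a section `Y`. -/
def lieDeriv (X : Sec I F A) (β : OneForm I F A) (Y : Sec I F A) (x : M) : ℝ :=
  L.d (fun y => β y (X y)) x (Y x) + L.dOne β X Y x

theorem lieDeriv_eq (X : Sec I F A) (β : OneForm I F A) (Y : Sec I F A) (x : M) :
    L.lieDeriv X β Y x = L.d (fun y => β y (Y y)) x (X x) - β x (L.bracket X Y x) := by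
  simp only [lieDeriv, dOne]
  exact (show ∀ a b c : ℝ, a + (b - a - c) = b - c from fun a b c => by ring) _ _ _

/-- The deformed bracket `[X, Y]_N = [NX, Y] + [X, NY] - N[X, Y]`. -/
def deformedBracket (N : Endo I F A) (X Y : Sec I F A) : Sec I F A :=
  L.bracket (BundleHom.app N X) Y + L.bracket X (BundleHom.app N Y)
    - BundleHom.app N (L.bracket X Y)

/-- `N` is a Nijenhuis operator: `N[X, Y]_N - [NX, NY] = 0` for all sections. -/
def IsNijenhuis (N : Endo I F A) : Prop :=
  ∀ X Y : Sec I F A,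
    BundleHom.app N (L.deformedBracket N X Y)
      - L.bracket (BundleHom.app N X) (BundleHom.app N Y) = 0

/-- The Schouten bracket `[P, Q]_A ∈ Γ(∧³A)` of two bivectors, evaluated on three forms: the cyclic
sum over `(α, β, γ)` of `⟨ℒ_{P♯α} β, Q♯γ⟩ + ⟨ℒ_{Q♯α} β, P♯γ⟩`. -/
def schouten (P Q : Bivector I F A) (α β γ : OneForm I F A) (x : M) : ℝ :=
  let t : OneForm I F A → OneForm I F A → OneForm I F A → ℝ := fun a b c =>
    L.lieDeriv (BundleHom.app P.sharp a) b (BundleHom.app Q.sharp c) x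
      + L.lieDeriv (BundleHom.app Q.sharp a) b (BundleHom.app P.sharp c) x
  t α β γ + t β γ α + t γ α β

/-- `π` is a Poisson structure on `A`: `[π, π]_A = 0`. -/
def IsPoisson (P : Bivector I F A) : Prop :=
  ∀ (α β γ : OneForm I F A) (x : M), L.schouten P P α β γ x = 0

/-- The bracket `[α, β]_π = ℒ_{π♯α} β - ℒ_{π♯β} α - d_A (π(α, β))` of forms of degree one,
evaluated on a section `Y`. -/
def formBracket (P : Bivector I F A) (α β : OneForm I F A) (Y : Sec I F A) (x : M) : ℝ :=
  L.lieDeriv (BundleHom.app P.sharp α) β Y x - L.lieDeriv (BundleHom.app P.sharp β) α Y x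
    - L.d (fun y => β y (P.sharp y (α y))) x (Y x)

/-- The deformation `[α, β]_{N*} = [N*α, β]_π + [α, N*β]_π - N*[α, β]_π` of the bracket `[ , ]_π`
along `N*`, evaluated on a section `Y`. -/
def deformedFormBracket (P : Bivector I F A) (N : Endo I F A) (α β : OneForm I F A)
    (Y : Sec I F A) (x : M) : ℝ :=
  L.formBracket P (N.transpose α) β Y x + L.formBracket P α (N.transpose β) Y x
    - L.formBracket P α β (BundleHom.app N Y) x

/-- The differential `d_π f = [π, f]_A = -π♯ (d_A f)` of a function for the Lie algebroid
`(A*, [ , ]_π, ρ ∘ π♯)`, at the point `x`. -/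
def dPoisson (P : Bivector I F A) (f : M → ℝ) (x : M) : A x := -P.sharp x (L.d f x)

/-- `d_π f`, as a form on `A*`, sends `α` to `ρ(π♯ α)·f`. -/
theorem dPoisson_pairing (P : Bivector I F A) (f : M → ℝ) (x : M) (a : DualFibre A x) :
    a (L.dPoisson P f x) = dirDeriv f x (L.anchor x (P.sharp x a)) := by
  have h := P.skew x a (L.d f x)
  simp only [dPoisson, map_neg]
  exact h.symm

/-- The modular vector field `X_{(N,π)} = d_π (Tr N)`. -/
def modularVectorField (N : Endo I F A) (P : Bivector I F A) (x : M) : A x :=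
  L.dPoisson P N.trace x

end LieAlgebroid

/-- `N π♯ = π♯ N*`, i.e. `N ∘ π♯` is skew-symmetric and so defines a bivector `Nπ`. -/
def Commutes (N : Endo I F A) (P : Bivector I F A) : Prop :=
  ∀ (x : M) (a : DualFibre A x), N x (P.sharp x a) = P.sharp x (a.comp (N x))

/-- The bivector `Nπ`, with `(Nπ)♯ = N ∘ π♯`. -/
def Bivector.twist (P : Bivector I F A) (N : Endo I F A) (h : Commutes N P) : Bivector I F A where
  sharp := BundleHom.comp N P.sharp
  skew x a b := by
    have h1 := P.skew x a (b.comp (N x))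
    rw [← h x b] at h1
    exact h1

theorem Commutes.pow [ContMDiffVectorBundle ∞ F A I] {N : Endo I F A} {P : Bivector I F A}
    (h : Commutes N P) (k : ℕ) : Commutes (N.pow k) P := by
  induction k with
  | zero => exact fun x a => rfl
  | succ k ih =>
    intro x a
    have h1 : (N.pow (k + 1)) x (P.sharp x a) = N x (N.pow k x (P.sharp x a)) := rfl
    have h2 : a.comp (N.pow (k + 1) x) = (a.comp (N x)).comp (N.pow k x) := rfl
    rw [h1, h2, ih x a, h x, ← ih x (a.comp (N x)), ← h x a, h x, ih x]
    have h3 : ∀ k, (N.pow k x).comp (N x) = (N x).comp (N.pow k x) := by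
      intro k
      induction k with
      | zero => rfl
      | succ k ih' =>
        change ((N x).comp (N.pow k x)).comp (N x) = (N x).comp ((N x).comp (N.pow k x))
        rw [ContinuousLinearMap.comp_assoc, ih']
    rw [ContinuousLinearMap.comp_assoc, ContinuousLinearMap.comp_assoc, h3]

/-- A Poisson-Nijenhuis structure on the Lie algebroid `A`: a Poisson structure `π` and a Nijenhuis
operator `N` which are compatible, i.e. `Nπ` is a bivector and `[ , ]_{Nπ} = [ , ]_{N*}`. -/
structure PNStructure (L : LieAlgebroid I F A) where
  /-- the Poisson structure -/
  P : Bivector I F A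
  /-- the Nijenhuis operator -/
  N : Endo I F A
  poisson : L.IsPoisson P
  nijenhuis : L.IsNijenhuis N
  commutes : Commutes N P
  compatible : ∀ (α β : OneForm I F A) (Y : Sec I F A) (x : M),
    L.formBracket (P.twist N commutes) α β Y x = L.deformedFormBracket P N α β Y x

/-- The bivector `N^i π` of a Poisson-Nijenhuis structure. -/
def PNStructure.powBivector [ContMDiffVectorBundle ∞ F A I] {L : LieAlgebroid I F A}
    (S : PNStructure L) (i : ℕ) : Bivector I F A :=
  S.P.twist (S.N.pow i) (S.commutes.pow i)

end Algebroid

end PN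

end

open Topology Module

/-- A derivation `D` along a ring homomorphism `ev`, applied to the power of a matrix under the
trace. -/
theorem Matrix.trace_mul_map_pow_of_leibniz {n R K : Type*} [Fintype n] [DecidableEq n]
    [CommRing R] [CommRing K] (ev : R →+* K) (D : R →+ K)
    (hD : ∀ f g, D (f * g) = ev f * D g + ev g * D f) (a : Matrix n n R) (m : ℕ)
    (B : Matrix n n K) (hB : Commute B (a.map ev)) :
    (B * (a ^ (m + 1)).map D).trace = (m + 1) * (B * (a.map ev) ^ m * a.map D).trace := by
  have hmul : ∀ s t : Matrix n n R,
      (s * t).map D = s.map ev * t.map D + s.map D * t.map ev := by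
    intro s t
    ext i j
    simp only [Matrix.map_apply, Matrix.mul_apply, map_sum, hD, Matrix.add_apply,
      Finset.sum_add_distrib, mul_comm (D _)]
  have hpow : ∀ k, (a ^ k).map ev = (a.map ev) ^ k := fun k => map_pow ev.mapMatrix a k
  induction m generalizing B with
  | zero => simp
  | succ m ih =>
    rw [pow_succ' a (m + 1), hmul, Matrix.mul_add, Matrix.trace_add, ← Matrix.mul_assoc,
      ih (B * a.map ev) (hB.mul_left (Commute.refl _)), hpow]
    have h1 : (B * (a.map D * a.map ev ^ (m + 1))).trace
        = (B * a.map ev ^ (m + 1) * a.map D).trace := by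
      rw [← Matrix.mul_assoc, Matrix.trace_mul_comm, ← Matrix.mul_assoc,
        (hB.pow_right (m + 1)).eq]
    rw [h1, Matrix.mul_assoc B, ← pow_succ']
    push_cast
    ring

noncomputable section

namespace PN

section Frame

variable {E : Type*} [NormedAddCommGroup E] [NormedSpace ℝ E] [FiniteDimensional ℝ E]
  {H : Type*} [TopologicalSpace H] (I : ModelWithCorners ℝ E H)
  {M : Type*} [TopologicalSpace M] [ChartedSpace H M] [IsManifold I ∞ M] [T2Space M]

/-- A global smooth bump function which is `1` near `x` and supported in a given neighbourhood. -/
theorem exists_bump (x : M) {U : Set M} (hU : U ∈ 𝓝 x) :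
    ∃ χ : C^∞⟮I, M; ℝ⟯, (∀ᶠ y in 𝓝 x, χ y = 1) ∧ tsupport χ ⊆ U := by
  obtain ⟨f, hf, -⟩ := (SmoothBumpFunction.nhds_basis_support (I := I) hU).mem_iff.1 hU
  exact ⟨⟨f, f.contMDiff⟩, f.eventuallyEq_one, hf⟩

variable (F : Type*) [NormedAddCommGroup F] [NormedSpace ℝ F] [FiniteDimensional ℝ F]
  (A : M → Type*) [∀ x, AddCommGroup (A x)] [∀ x, Module ℝ (A x)]
  [TopologicalSpace (TotalSpace F A)] [∀ x, TopologicalSpace (A x)]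
  [FiberBundle F A] [VectorBundle ℝ F A] [ContMDiffVectorBundle ∞ F A I]

/-- Near each point there is a frame of global smooth sections, in which all smooth sections have
global smooth coefficients. -/
theorem exists_frame (x : M) : ∃ e : Fin (finrank ℝ F) → Sec I F A,
    (∀ᶠ y in 𝓝 x, ∃ b : Basis (Fin (finrank ℝ F)) ℝ (A y), ∀ i, b i = e i y) ∧
    ∀ X : Sec I F A, ∃ f : Fin (finrank ℝ F) → C^∞⟮I, M; ℝ⟯,
      ∀ᶠ y in 𝓝 x, X y = ∑ i, f i y • e i y := by
  have : ContMDiffVectorBundle 1 F A I := .of_le (n := ∞) (by simp)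
  let t := trivializationAt F A x
  have hx : x ∈ t.baseSet := FiberBundle.mem_baseSet_trivializationAt' x
  have hU : t.baseSet ∈ 𝓝 x := t.open_baseSet.mem_nhds hx
  let b := finBasis ℝ F
  obtain ⟨χ, hχ, hs⟩ := exists_bump I x hU
  refine ⟨fun i => ⟨fun y => χ y • t.localFrame b i y,
    ContMDiffOn.smul_section_of_tsupport χ.contMDiff.contMDiffOn t.open_baseSet hs
      (t.contMDiffOn_localFrame_baseSet ∞ b i)⟩, ?_, fun X => ?_⟩
  · filter_upwards [hχ, hU] with y hy hyU
    refine ⟨t.basisAt b hyU, fun i => ?_⟩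
    change _ = χ y • t.localFrame b i y
    rw [hy, one_smul, t.localFrame_apply_of_mem_baseSet b hyU]
  · refine ⟨fun i => ⟨fun y => χ y * t.localFrameCoeff I b i y (X y),
      contMDiff_of_tsupport fun y hy => ?_⟩, ?_⟩
    · have hyU : y ∈ t.baseSet := hs (closure_mono (Function.support_mul_subset_left _ _) hy)
      exact χ.contMDiff.contMDiffAt.mul
        (contMDiffAt_localFrameCoeff (k := ∞) b hyU X.contMDiff.contMDiffAt i)
    · filter_upwards [hχ, hU] with y hy hyU
      change X y = ∑ i, (χ y * t.localFrameCoeff I b i y (X y)) • χ y • t.localFrame b i y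
      simp only [hy, one_mul, one_smul]
      exact t.eq_sum_localFrameCoeff_smul (s := X) hyU

end Frame

section Algebroid

variable {E : Type*} [NormedAddCommGroup E] [NormedSpace ℝ E]
  {H : Type*} [TopologicalSpace H] {I : ModelWithCorners ℝ E H}
  {M : Type*} [TopologicalSpace M] [ChartedSpace H M] [IsManifold I ∞ M]
  {F : Type*} [NormedAddCommGroup F] [NormedSpace ℝ F]
  {A : M → Type*} [∀ x, AddCommGroup (A x)] [∀ x, Module ℝ (A x)]
  [TopologicalSpace (TotalSpace F A)] [∀ x, TopologicalSpace (A x)]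
  [FiberBundle F A] [VectorBundle ℝ F A]
  [∀ x, IsTopologicalAddGroup (A x)] [∀ x, ContinuousSMul ℝ (A x)]

/-- The derivative along a tangent vector, as an additive map on smooth functions. -/
def dirDerivHom (x : M) (v : TangentSpace I x) : C^∞⟮I, M; ℝ⟯ →+ ℝ :=
  AddMonoidHom.mk' (fun f => dirDeriv f x v) fun f g => by
    have hf : MDifferentiableAt I 𝓘(ℝ, ℝ) f x := f.contMDiff.contMDiffAt.mdifferentiableAt (by simp)
    have hg : MDifferentiableAt I 𝓘(ℝ, ℝ) g x := g.contMDiff.contMDiffAt.mdifferentiableAt (by simp)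
    exact congrArg (fun φ : TangentSpace I x →L[ℝ] ℝ => φ v) (mfderiv_add hf hg)

theorem dirDerivHom_mul (x : M) (v : TangentSpace I x) (f g : C^∞⟮I, M; ℝ⟯) :
    dirDerivHom x v (f * g) = f x * dirDerivHom x v g + g x * dirDerivHom x v f := by
  have hf : MDifferentiableAt I 𝓘(ℝ, ℝ) f x := f.contMDiff.contMDiffAt.mdifferentiableAt (by simp)
  have hg : MDifferentiableAt I 𝓘(ℝ, ℝ) g x := g.contMDiff.contMDiffAt.mdifferentiableAt (by simp)
  exact congrArg (fun φ : TangentSpace I x →L[ℝ] ℝ => φ v)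
    (hf.hasMFDerivAt.mul hg.hasMFDerivAt).mfderiv

theorem dirDeriv_congr {f g : M → ℝ} {x : M} (h : f =ᶠ[𝓝 x] g) (v : TangentSpace I x) :
    dirDeriv f x v = dirDeriv g x v := by
  simp only [dirDeriv]
  rw [h.mfderiv_eq]
  rfl

theorem Sec.sum_apply {ι : Type*} (s : Finset ι) (X : ι → Sec I F A) (x : M) :
    (∑ i ∈ s, X i) x = ∑ i ∈ s, X i x :=
  map_sum ((Pi.evalAddMonoidHom A x).comp (ContMDiffSection.coeAddHom I F ∞ A)) X s

/-- Evaluation of smooth functions at a point, as a ring homomorphism. -/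
def evalHom (I : ModelWithCorners ℝ E H) (x : M) : C^∞⟮I, M; ℝ⟯ →+* ℝ :=
  (Pi.evalRingHom (fun _ : M => ℝ) x).comp ContMDiffMap.coeFnRingHom

namespace LieAlgebroid

variable (L : LieAlgebroid I F A)

theorem d_apply (f : M → ℝ) (x : M) (v : A x) : L.d f x v = dirDeriv f x (L.anchor x v) := rfl

/-- The bracket is local in its second argument. -/
theorem bracket_congr [FiniteDimensional ℝ E] [T2Space M] (Z : Sec I F A) {X Y : Sec I F A} {x : M}
    (h : ∀ᶠ y in 𝓝 x, X y = Y y) : L.bracket Z X x = L.bracket Z Y x := by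
  obtain ⟨χ, hχ, hs⟩ := exists_bump I x h
  have hXY : X.fsmul χ = Y.fsmul χ := by
    ext y
    change χ y • X y = χ y • Y y
    by_cases hy : y ∈ tsupport χ
    · rw [hs hy]
    · rw [image_eq_zero_of_notMem_tsupport hy, zero_smul, zero_smul]
  have h1 := L.leibniz Z X χ x
  rw [hXY, L.leibniz Z Y χ x, hχ.self_of_nhds, one_smul, one_smul, h.self_of_nhds] at h1
  exact (add_right_cancel h1).symm

theorem bracket_sum_fsmul {ι : Type*} [Fintype ι] (Z : Sec I F A) (f : ι → C^∞⟮I, M; ℝ⟯)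
    (e : ι → Sec I F A) (x : M) :
    L.bracket Z (∑ i, (e i).fsmul (f i)) x =
      ∑ i, (f i x • L.bracket Z (e i) x + dirDeriv (f i) x (L.anchor x (Z x)) • e i x) := by
  rw [map_sum]
  simp only [← L.leibniz]
  exact Sec.sum_apply _ _ x

/-- For a Nijenhuis operator, `ℒ_{N^p X} N = N^p ∘ ℒ_X N`. -/
theorem IsNijenhuis.bracket_pow [ContMDiffVectorBundle ∞ F A I] {L : LieAlgebroid I F A}
    {N : Endo I F A} (hN : L.IsNijenhuis N) (p : ℕ) (X Y : Sec I F A) (x : M) :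
    L.bracket (BundleHom.app (N.pow p) X) (BundleHom.app N Y) x
        - N x (L.bracket (BundleHom.app (N.pow p) X) Y x) =
      N.pow p x (L.bracket X (BundleHom.app N Y) x - N x (L.bracket X Y x)) := by
  induction p with
  | zero => rfl
  | succ p ih =>
    have h := congrArg (fun s : Sec I F A => s x) (hN (BundleHom.app (N.pow p) X) Y)
    have h' : N x (L.bracket (BundleHom.app (N.pow (p + 1)) X) Y x
        + L.bracket (BundleHom.app (N.pow p) X) (BundleHom.app N Y) x
        - N x (L.bracket (BundleHom.app (N.pow p) X) Y x))
        - L.bracket (BundleHom.app (N.pow (p + 1)) X) (BundleHom.app N Y) x = 0 := h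
    change _ = N x (N.pow p x _)
    rw [← ih, ← sub_eq_zero.1 h', add_sub_assoc, map_add]
    abel

end LieAlgebroid

theorem Endo.coe_pow [ContMDiffVectorBundle ∞ F A I] (N : Endo I F A) (p : ℕ) (x : M) :
    (N.pow p x : A x →ₗ[ℝ] A x) = (N x : A x →ₗ[ℝ] A x) ^ p := by
  induction p with
  | zero => rfl
  | succ p ih =>
    rw [pow_succ', ← ih]
    rfl

/-- For a Nijenhuis operator, `d_A (Tr N^{p+1}) = (p + 1) (N*)^p d_A (Tr N)`. -/
theorem LieAlgebroid.IsNijenhuis.d_trace_pow [FiniteDimensional ℝ E] [FiniteDimensional ℝ F]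
    [T2Space M] [ContMDiffVectorBundle ∞ F A I] {L : LieAlgebroid I F A} {N : Endo I F A}
    (hN : L.IsNijenhuis N) (p : ℕ) (x : M) (v : A x) :
    L.d (N.pow (p + 1)).trace x v = (p + 1) * L.d N.trace x (N.pow p x v) := by
  obtain ⟨e, hb, he⟩ := exists_frame I F A x
  choose f hf using fun j => he (BundleHom.app N (e j))
  let a : Matrix (Fin (finrank ℝ F)) (Fin (finrank ℝ F)) C^∞⟮I, M; ℝ⟯ := .of fun i j => f j i
  have hmat : ∀ᶠ y in 𝓝 x, ∀ b : Basis (Fin (finrank ℝ F)) ℝ (A y), (∀ i, b i = e i y) →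
      LinearMap.toMatrix b b (N y : A y →ₗ[ℝ] A y) = a.map (evalHom I y) := by
    filter_upwards [Filter.eventually_all.2 hf] with y hy b hbe
    refine (LinearEquiv.eq_symm_apply _).1 (b.ext fun j => ?_)
    rw [LinearMap.toMatrix_symm, Matrix.toLin_self]
    simp only [hbe]
    exact hy j
  have htr : ∀ m, (N.pow m).trace =ᶠ[𝓝 x] ((a ^ m).trace : C^∞⟮I, M; ℝ⟯) := by
    intro m
    filter_upwards [hb, hmat] with y ⟨b, hbe⟩ hy
    rw [Endo.trace, Endo.coe_pow, LinearMap.trace_eq_matrix_trace ℝ b, ← LinearMap.toMatrix_pow,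
      hy b hbe, ← RingHom.mapMatrix_apply, ← map_pow, RingHom.mapMatrix_apply,
      ← AddMonoidHom.map_trace (evalHom I y)]
    rfl
  have htr1 : N.trace =ᶠ[𝓝 x] (a.trace : C^∞⟮I, M; ℝ⟯) := by
    have h : (N.pow 1).trace = N.trace := rfl
    rw [← h, ← pow_one a]
    exact htr 1
  obtain ⟨b, hbe⟩ := hb.self_of_nhds
  let n : A x →ₗ[ℝ] A x := N x
  let X : Sec I F A := ∑ i, b.repr v i • e i
  have hX : X x = v := by
    rw [← b.sum_repr v]
    simp only [hbe]
    exact Sec.sum_apply _ _ x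
  let ad (Z : Sec I F A) : A x →ₗ[ℝ] A x := b.constr ℝ fun j => L.bracket Z (e j) x
  let D (Z : Sec I F A) : C^∞⟮I, M; ℝ⟯ →+ ℝ := dirDerivHom x (L.anchor x (Z x))
  have hLie : ∀ Z : Sec I F A, ∀ j,
      L.bracket Z (BundleHom.app N (e j)) x - N x (L.bracket Z (e j) x) =
        (Matrix.toLin b b (a.map (D Z)) + ad Z * n - n * ad Z) (b j) := by
    intro Z j
    have h1 : ∀ᶠ y in 𝓝 x, BundleHom.app N (e j) y = (∑ i, (e i).fsmul (f j i) : Sec I F A) y := by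
      filter_upwards [hf j] with y hy
      rw [hy]
      exact (Sec.sum_apply Finset.univ (fun i => (e i).fsmul (f j i)) y).symm
    have h2 : n (b j) = ∑ i, f j i x • b i := by
      rw [hbe]
      simp only [hbe]
      exact (hf j).self_of_nhds
    rw [L.bracket_congr Z h1, L.bracket_sum_fsmul, LinearMap.sub_apply, LinearMap.add_apply,
      Module.End.mul_apply, Module.End.mul_apply, Matrix.toLin_self, h2, map_sum]
    simp only [map_smul, ad, b.constr_basis, Finset.sum_add_distrib]
    rw [add_comm]
    simp only [hbe]
    rfl
  let Z := BundleHom.app (N.pow p) X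
  have hop : Matrix.toLin b b (a.map (D Z)) + ad Z * n - n * ad Z =
      n ^ p * (Matrix.toLin b b (a.map (D X)) + ad X * n - n * ad X) := by
    refine b.ext fun j => ?_
    rw [← hLie, Module.End.mul_apply, ← hLie, hN.bracket_pow, ← Endo.coe_pow]
    rfl
  have hmain : (a.map (D Z)).trace = ((a.map (evalHom I x)) ^ p * a.map (D X)).trace := by
    have h := congrArg (LinearMap.trace ℝ (A x)) hop
    rw [add_sub_assoc, add_sub_assoc, mul_add, mul_sub, map_add, map_add, map_sub, map_sub,
      LinearMap.trace_mul_comm ℝ (ad Z), sub_self, add_zero, ← mul_assoc, ← mul_assoc,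
      LinearMap.trace_mul_comm ℝ _ n, ← mul_assoc, ← pow_succ, ← pow_succ', sub_self, add_zero,
      LinearMap.trace_eq_matrix_trace ℝ b, LinearMap.trace_eq_matrix_trace ℝ b,
      LinearMap.toMatrix_mul, ← LinearMap.toMatrix_pow, LinearMap.toMatrix_toLin,
      LinearMap.toMatrix_toLin, hmat.self_of_nhds b hbe] at h
    exact h
  have hpow := Matrix.trace_mul_map_pow_of_leibniz (evalHom I x) (D X)
    (dirDerivHom_mul x _) a p 1 (Commute.one_left _)
  rw [one_mul, one_mul, ← hmain] at hpow
  rw [L.d_apply, L.d_apply, dirDeriv_congr (htr (p + 1)), dirDeriv_congr htr1]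
  have hZ : Z x = N.pow p x v := congrArg (N.pow p x) hX
  rw [← hZ, ← hX]
  change D X _ = (p + 1) * D Z _
  rw [AddMonoidHom.map_trace, AddMonoidHom.map_trace]
  exact hpow

end Algebroid

end PN

end

theorem mainTheorem4
    {E : Type*} [NormedAddCommGroup E] [NormedSpace ℝ E] [FiniteDimensional ℝ E]
    {H : Type*} [TopologicalSpace H] (I : ModelWithCorners ℝ E H) [I.Boundaryless]
    {M : Type*} [TopologicalSpace M] [ChartedSpace H M] [IsManifold I ∞ M]
    [T2Space M] [SigmaCompactSpace M]
    (F : Type*) [NormedAddCommGroup F] [NormedSpace ℝ F] [FiniteDimensional ℝ F]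
    (A : M → Type*) [∀ x, AddCommGroup (A x)] [∀ x, Module ℝ (A x)]
    [TopologicalSpace (Bundle.TotalSpace F A)] [∀ x, TopologicalSpace (A x)]
    [∀ x, IsTopologicalAddGroup (A x)] [∀ x, ContinuousSMul ℝ (A x)]
    [FiberBundle F A] [VectorBundle ℝ F A] [ContMDiffVectorBundle ∞ F A I]
    (L : PN.LieAlgebroid I F A) (S : PN.PNStructure L) (i k : ℕ) (hik : i < k) (x : M) :
    S.N.pow k x (L.modularVectorField S.N S.P x) =
      (1 / ((k - i + 1 : ℕ) : ℝ)) •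
        L.modularVectorField (S.N.pow (k - i + 1)) (S.powBivector i) x := by
  obtain ⟨p, rfl⟩ := Nat.exists_eq_add_of_lt hik
  have hp : i + p + 1 - i = p + 1 := by omega
  have hpow : S.N.pow (i + p + 1) x = (S.N.pow i x).comp (S.N.pow (p + 1) x) := by
    ext w
    have h := congrArg (fun φ : A x →ₗ[ℝ] A x => φ w)
      ((S.N.coe_pow (i + p + 1) x).trans (pow_add _ i (p + 1)))
    simp only [← PN.Endo.coe_pow] at h
    exact h
  have hd : L.d (S.N.pow (p + 1 + 1)).trace x =
      ((p + 1 + 1 : ℕ) : ℝ) • (L.d S.N.trace x).comp (S.N.pow (p + 1) x) := by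
    ext w
    have h := S.nijenhuis.d_trace_pow (p + 1) x w
    rw [h]
    push_cast
    rfl
  have hne : ((p + 1 + 1 : ℕ) : ℝ) ≠ 0 := by positivity
  rw [hp, hpow]
  change S.N.pow i x (S.N.pow (p + 1) x (-S.P.sharp x (L.d S.N.trace x))) =
    (1 / ((p + 1 + 1 : ℕ) : ℝ)) •
      -S.N.pow i x (S.P.sharp x (L.d (S.N.pow (p + 1 + 1)).trace x))
  rw [hd, map_neg, map_neg, S.commutes.pow (p + 1) x, map_smul, map_smul, smul_neg, smul_smul,
    one_div_mul_cancel hne, one_smul]
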